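/- **Conventions.** Let $\mathcal A$ be an abelian category with enough projectives and let $\mathcal P$ be its class of projective objects. The *stable category* $\underline{\mathcal A}$ has the same objects as $\mathcal A$ (an object $A$ is written $\underline A$ there), and its morphisms are the morphisms of $\mathcal A$ modulo those that factor through a projective object. Choosing exact sequences $0\to\Omega A\to P_A\to A\to 0$ with $P_A$ projective gives a functor $\Omega\colon\underline{\mathcal A}\to\underline{\mathcal A}$. The *costabilization* $\mathcal R(\underline{\mathcal A})$ has as objects the sequences $(\underline{A_n},\alpha_n)_{n\in\mathbb Z}$ with isomorphisms $\alpha_n\colon \underline{A_n}\to\Omega\underline{A_{n+1}}$ in $\underline{\mathcal A}$, and as morphisms $(\underline{A_n},\alpha_n)\to(\underline{B_n},\beta_n)$ the sequences of morphisms $f_n\colon\underline{A_n}\to\underline{B_n}$ in $\underline{\mathcal A}$ with $\beta_n f_n=\Omega(f_{n+1})\alpha_n$. Let $R\colon\mathcal R(\underline{\mathcal A})\to\underline{\mathcal A}$, $(\underline{A_n},\alpha_n)\mapsto\underline{A_0}$, be the forgetful functor, with essential image $\operatorname{im}R$. The category $\mathcal A$ is *$\mathcal P$-Co-Gorenstein*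 if 1. $R$ is full and faithful, and 2. for every short exact sequence $0\to A_1\to A_2\to A_3\to 0$ in $\mathcal A$ with $\underline{A_1},\underline{A_3}\in\operatorname{im}R$, one has $\underline{A_2}\in\operatorname{im}R$. Let $\Omega^\infty(\mathcal A)$ be the class of objects $A$ for which there is an exact sequence $0\to A\to P_0\to P_1\to\cdots$ with all $P_i$ projective. For a ring $\Lambda$, let $\operatorname{Mod}\text{-}\Lambda$ be the category of all right $\Lambda$-modules and $\operatorname{mod}\text{-}\Lambda$ the category of finitely generated ones. A right noetherian ring $\Lambda$ is *right Co-Gorenstein* if $\operatorname{mod}\text{-}\Lambda$ is $\mathcal P$-Co-Gorenstein. A two-sided noetherian ring $\Lambda$ is *Iwanaga-Gorenstein* if it has finite injective dimension as a left and as a right module over itself. Finally, $\operatorname{add}\Lambda$ is the class of direct summands of finite direct sums of copies of the right module $\Lambda$. **Statement.** Let $k$ be a field and let $\Lambda=k[x,y]/(x^2,xy,yx,y^2)$. Then $\Lambda$ is a local $k$-algebra of dimension $3$ whose Jacobson radical has square zero, and: * $\Lambda$ is right Co-Gorenstein; * $\Lambda$ is not Iwanaga-Gorenstein; * $\Omega^\infty(\operatorname{mod}\text{-}\Lambda)=\operatorname{add}\Lambda$;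 * $\operatorname{Mod}\text{-}\Lambda$ is not $\mathcal P$-Co-Gorenstein. -/

import Mathlib

open CategoryTheory CategoryTheory.Limits

universe v u

noncomputable section

namespace CoGor

attribute [local instance] Abelian.hasFiniteBiproducts

section Stable

variable (C : Type u) [Category.{v} C] [Abelian C]

variable {C} in
/-- A morphism factors through a projective object. -/
def FactorsThroughProjective {X Y : C} (f : X ⟶ Y) : Prop :=
  ∃ (P : C) (_ : Projective P) (a : X ⟶ P) (b : P ⟶ Y), a ≫ b = f

/-- `f ∼ g` if and only if `f - g` factors through a projective object. -/
def stableRel : HomRel C := fun _ _ f g => FactorsThroughProjective (f - g)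

open scoped ZeroObject in
/-- The relation `∼` is a congruence, so that the quotient category below has as morphisms
exactly the equivalence classes of morphisms for `∼`. -/
instance stableRel_congruence : Congruence (stableRel C) where
  equivalence := by
    intro X Y
    refine ⟨fun f => ?_, ?_, ?_⟩
    · exact ⟨(0 : C), inferInstance, 0, 0, by simp⟩
    · rintro f g ⟨P, hP, a, b, h⟩
      exact ⟨P, hP, -a, b, by simp [h]⟩
    · rintro f g h ⟨P, hP, a, b, h₁⟩ ⟨Q, hQ, c, d, h₂⟩
      refine ⟨P ⊞ Q, inferInstance, biprod.lift a c, biprod.desc b d, ?_⟩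
      simp [h₁, h₂]
  comp_left := by
    rintro X Y Z f g g' ⟨P, hP, a, b, h⟩
    exact ⟨P, hP, f ≫ a, b, by simp [h]⟩
  comp_right := by
    rintro X Y Z f f' g ⟨P, hP, a, b, h⟩
    exact ⟨P, hP, a, b ≫ g, by rw [← Category.assoc, h, Preadditive.sub_comp]⟩

/-- The projectively stable category of `C`. -/
abbrev Stable := CategoryTheory.Quotient (stableRel C)

/-- The quotient functor from `C` to its projectively stable category. -/
abbrev toStable : C ⥤ Stable C := CategoryTheory.Quotient.functor (stableRel C)

end Stable

section Syzygy

set_option linter.unusedSectionVars false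

variable {C : Type u} [Category.{v} C] [Abelian C] [EnoughProjectives C]

/-- The chosen syzygy: the kernel of a chosen epimorphism onto `A` from a projective object. -/
def syzygy (A : C) : C := kernel (Projective.π A)

/-- The inclusion of the chosen syzygy into the chosen projective object. -/
def syzygyι (A : C) : syzygy A ⟶ Projective.over A := kernel.ι (Projective.π A)

instance (A : C) : Mono (syzygyι A) := inferInstanceAs (Mono (kernel.ι (Projective.π A)))

@[simp] lemma syzygyι_π (A : C) : syzygyι A ≫ Projective.π A = 0 := kernel.condition _

/-- A chosen lift of a morphism to the chosen projective objects. -/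
def overMap {A B : C} (f : A ⟶ B) : Projective.over A ⟶ Projective.over B :=
  Projective.factorThru (Projective.π A ≫ f) (Projective.π B)

@[simp] lemma overMap_π {A B : C} (f : A ⟶ B) :
    overMap f ≫ Projective.π B = Projective.π A ≫ f :=
  Projective.factorThru_comp _ _

/-- The map that `f` induces on the chosen syzygies. -/
def syzygyMap {A B : C} (f : A ⟶ B) : syzygy A ⟶ syzygy B :=
  kernel.lift (Projective.π B) (syzygyι A ≫ overMap f) (by
    rw [Category.assoc, overMap_π, ← Category.assoc, syzygyι_π, zero_comp])

@[simp] lemma syzygyMap_ι {A B : C} (f : A ⟶ B) :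
    syzygyMap f ≫ syzygyι B = syzygyι A ≫ overMap f :=
  kernel.lift_ι _ _ _

/-- A map of syzygies is stably determined by the map on the quotients. -/
lemma stableRel_of_lifts {A B : C} {f f' : A ⟶ B} (h : stableRel C f f')
    {g g' : Projective.over A ⟶ Projective.over B}
    (hg : g ≫ Projective.π B = Projective.π A ≫ f)
    (hg' : g' ≫ Projective.π B = Projective.π A ≫ f')
    {s s' : syzygy A ⟶ syzygy B} (hs : s ≫ syzygyι B = syzygyι A ≫ g)
    (hs' : s' ≫ syzygyι B = syzygyι A ≫ g') : stableRel C s s' := by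
  obtain ⟨P, hP, a, b, hab⟩ := h
  let b' : P ⟶ Projective.over B := Projective.factorThru b (Projective.π B)
  have hb' : b' ≫ Projective.π B = b := Projective.factorThru_comp _ _
  let t : Projective.over A ⟶ syzygy B :=
    kernel.lift (Projective.π B) (g - g' - Projective.π A ≫ a ≫ b') (by
      simp only [Preadditive.sub_comp, Category.assoc, hb', hg, hg', hab, Preadditive.comp_sub,
        sub_self])
  have ht : t ≫ syzygyι B = g - g' - Projective.π A ≫ a ≫ b' := kernel.lift_ι _ _ _
  refine ⟨Projective.over A, inferInstance, syzygyι A, t, ?_⟩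
  rw [← cancel_mono (syzygyι B), Category.assoc, ht, Preadditive.sub_comp, hs, hs',
    Preadditive.comp_sub, Preadditive.comp_sub, ← Category.assoc (syzygyι A) (Projective.π A),
    syzygyι_π, zero_comp, sub_zero]

variable (C) in
/-- Taking syzygies, as a functor from `C` to the stable category. -/
def syzygyFunctor : C ⥤ Stable C where
  obj A := (toStable C).obj (syzygy A)
  map f := (toStable C).map (syzygyMap f)
  map_id A := by
    rw [← (toStable C).map_id]
    apply CategoryTheory.Quotient.sound
    exact stableRel_of_lifts ((stableRel_congruence C).equivalence.refl (𝟙 A))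
      (g := overMap (𝟙 A)) (g' := 𝟙 _) (by simp) (by simp) (by simp) (by simp)
  map_comp {X Y Z} f g := by
    rw [← (toStable C).map_comp]
    apply CategoryTheory.Quotient.sound
    refine stableRel_of_lifts ((stableRel_congruence C).equivalence.refl (f ≫ g))
      (g := overMap (f ≫ g)) (g' := overMap f ≫ overMap g) (by simp) ?_ (by simp) ?_
    · rw [Category.assoc, overMap_π, ← Category.assoc, overMap_π, Category.assoc]
    · rw [Category.assoc, syzygyMap_ι, ← Category.assoc, syzygyMap_ι, Category.assoc]

variable (C) in
/-- The syzygy functor `Ω` of the stable category. -/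
def Ω : Stable C ⥤ Stable C :=
  CategoryTheory.Quotient.lift (stableRel C) (syzygyFunctor C) (by
    intro A B f f' h
    exact CategoryTheory.Quotient.sound _ (stableRel_of_lifts h (overMap_π f) (overMap_π f')
      (syzygyMap_ι f) (syzygyMap_ι f')))

end Syzygy

section Costabilization

/-- Objects of the costabilization of a category `D` with an endofunctor `T`: sequences of
objects `Aₙ`, `n ∈ ℤ`, with isomorphisms `αₙ : Aₙ ≅ T Aₙ₊₁`. -/
structure Costabilization {D : Type u} [Category.{v} D] (T : D ⥤ D) where
  obj : ℤ → D
  iso : ∀ n : ℤ, obj n ≅ T.obj (obj (n + 1))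

variable {D : Type u} [Category.{v} D] {T : D ⥤ D}

/-- Morphisms of the costabilization: sequences `fₙ` with `βₙ ∘ fₙ = T(fₙ₊₁) ∘ αₙ`. -/
@[ext]
structure Costabilization.Hom (A B : Costabilization T) where
  app : ∀ n : ℤ, A.obj n ⟶ B.obj n
  comm : ∀ n : ℤ, app n ≫ (B.iso n).hom = (A.iso n).hom ≫ T.map (app (n + 1))

instance : Category (Costabilization T) where
  Hom A B := Costabilization.Hom A B
  id A := { app := fun n => 𝟙 _, comm := by simp }
  comp f g :=
    { app := fun n => f.app n ≫ g.app n
      comm := fun n => by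
        rw [Category.assoc, g.comm, ← Category.assoc, f.comm, Category.assoc, T.map_comp] }
  id_comp f := by apply Costabilization.Hom.ext; funext n; exact Category.id_comp _
  comp_id f := by apply Costabilization.Hom.ext; funext n; exact Category.comp_id _
  assoc f g h := by apply Costabilization.Hom.ext; funext n; exact Category.assoc _ _ _

/-- The forgetful functor `(Aₙ, αₙ) ↦ A₀` from the costabilization. -/
def Costabilization.forget (T : D ⥤ D) : Costabilization T ⥤ D where
  obj A := A.obj 0
  map f := f.app 0
  map_id _ := rfl
  map_comp _ _ := rfl

end Costabilization

/-- An abelian category with enough projectives is `𝒫`-Co-Gorenstein if the forgetful functor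
from the costabilization of its stable category (with respect to `Ω`) is fully faithful and its
essential image is closed under extensions. -/
structure IsPCoGorenstein (C : Type u) [Category.{v} C] [Abelian C] [EnoughProjectives C] :
    Prop where
  full : (Costabilization.forget (Ω C)).Full
  faithful : (Costabilization.forget (Ω C)).Faithful
  extension_closed : ∀ S : ShortComplex C, S.ShortExact →
    (Costabilization.forget (Ω C)).essImage ((toStable C).obj S.X₁) →
    (Costabilization.forget (Ω C)).essImage ((toStable C).obj S.X₃) →
    (Costabilization.forget (Ω C)).essImage ((toStable C).obj S.X₂)

/-- `Ω^∞(C)`: the objects `A` for which there is an exact sequence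
`0 ⟶ A ⟶ P₀ ⟶ P₁ ⟶ ⋯` with all `Pᵢ` projective. -/
def OmegaInfty (C : Type u) [Category.{v} C] [Abelian C] : ObjectProperty C := fun A =>
  ∃ (P : ℕ → C) (i : A ⟶ P 0) (d : ∀ n : ℕ, P n ⟶ P (n + 1))
    (w₀ : i ≫ d 0 = 0) (w : ∀ n : ℕ, d n ≫ d (n + 1) = 0),
    (∀ n, Projective (P n)) ∧ Mono i ∧ (ShortComplex.mk i (d 0) w₀).Exact ∧
      ∀ n, (ShortComplex.mk (d n) (d (n + 1)) (w n)).Exact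

/-- `add X`: the direct summands (equivalently, in an abelian category, the retracts) of finite
direct sums of copies of `X`. -/
def addClosure {C : Type u} [Category.{v} C] [Abelian C] (X : C) : ObjectProperty C := fun M =>
  ∃ n : ℕ, Nonempty (Retract M (⨁ fun _ : Fin n => X))

section Rings

/-- The category of all right modules over `A`. -/
abbrev RightMod (A : Type u) [Ring A] := ModuleCat.{u} Aᵐᵒᵖ

/-- The category of finitely generated right modules over `A`. -/
abbrev FGRightMod (A : Type u) [Ring A] := FGModuleCat.{u} Aᵐᵒᵖ

/-- Finitely generated modules over a noetherian ring have enough projectives. -/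
instance fgModuleCat_enoughProjectives (A : Type u) [Ring A] [IsNoetherianRing A] :
    EnoughProjectives (FGModuleCat.{u} A) where
  presentation M := by
    obtain ⟨n, f, hf⟩ := Module.Finite.exists_fin' A M
    let F := FGModuleCat.of A (Fin n → A)
    have hF : Projective F := by
      apply (forget₂ (FGModuleCat.{u} A) (ModuleCat.{u} A)).projective_of_map_projective
      exact (inferInstance : Projective (ModuleCat.of A (Fin n → A)))
    let g : F ⟶ M := ObjectProperty.homMk (ModuleCat.ofHom f)
    have hg : Epi g := by
      have : Epi ((forget₂ (FGModuleCat.{u} A) (ModuleCat.{u} A)).map g) :=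
        (ModuleCat.epi_iff_surjective _).2 hf
      exact (forget₂ (FGModuleCat.{u} A) (ModuleCat.{u} A)).epi_of_epi_map this
    exact ⟨⟨F, g⟩⟩

/-- `A` is right Co-Gorenstein if the category of finitely generated right `A`-modules is
`𝒫`-Co-Gorenstein. -/
def IsRightCoGorenstein (A : Type u) [Ring A] [IsNoetherianRing Aᵐᵒᵖ] : Prop :=
  IsPCoGorenstein (FGRightMod A)

/-- A two-sided noetherian ring is Iwanaga-Gorenstein if it has finite injective dimension both
as a left and as a right module over itself. -/
def IsIwanagaGorenstein (A : Type u) [Ring A] [IsNoetherianRing A] [IsNoetherianRing Aᵐᵒᵖ] :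
    Prop :=
  (∃ n : ℕ, HasInjectiveDimensionLE (ModuleCat.of A A) n) ∧
    ∃ n : ℕ, HasInjectiveDimensionLE (ModuleCat.of Aᵐᵒᵖ A) n

/-- The opposite of a commutative noetherian ring is noetherian. -/
instance isNoetherianRing_mop (A : Type u) [CommRing A] [IsNoetherianRing A] :
    IsNoetherianRing Aᵐᵒᵖ :=
  isNoetherianRing_of_ringEquiv A (RingEquiv.toOpposite A)

/-- The ring `A` is finitely generated as a right module over itself. -/
instance finite_mop_self (A : Type u) [Ring A] : Module.Finite Aᵐᵒᵖ A :=
  Module.Finite.of_surjective (MulOpposite.opLinearEquiv Aᵐᵒᵖ : A ≃ₗ[Aᵐᵒᵖ] Aᵐᵒᵖ).symm.toLinearMap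
    (LinearEquiv.surjective _)

end Rings

open MvPolynomial in
/-- The algebra `k[x, y] / (x², xy, yx, y²)`. -/
abbrev Lam (k : Type u) [Field k] : Type u :=
  MvPolynomial (Fin 2) k ⧸ (Ideal.span {X 0 ^ 2, X 0 * X 1, X 1 * X 0, X 1 ^ 2} :
    Ideal (MvPolynomial (Fin 2) k))

end CoGor

end

/-! Only two properties of the local ring matter for the categorical claims: its maximal ideal `m`
satisfies `m² = 0` and is not principal. Hence `m ≅ κ^d` with `κ` the residue field and `d ≥ 2`.

Finitely generated modules: the kernel of a minimal cover lies in `m` times a free module, so every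
syzygy is stably some `κ^c`, and `Ω(κ^c) ≅ κ^(cd)`. Maps between modules killed by `m` vanish once
they factor through a projective (`comp_eq_zero_of_projective`), so `c` is a stable invariant. A
chain `Aₙ ≅ Ω Aₙ₊₁` gives `cₙ = cₙ₊₁ d`, so every power of `d` divides `c₀`, and `c₀ = 0`
(`projective_of_syzygy_chain`). Both the costabilization and `Ω^∞` therefore contain only
projectives.

Arbitrary modules: divisibility is no obstruction for `κ^(ℕ) ≅ m^(ℕ)`, which is its own syzygy. It
defines a constant object of the costabilization, and fullness would extend every endomorphism of
`m^(ℕ)` to `R^(ℕ)`. Swapping two basis vectors of `m` is not multiplication by a ring element, so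
this fails. The same swap shows `Ext¹(κ^(ℕ), R) ≠ 0`, and self-syzygy shifts this to all positive
degrees, so `R` has infinite injective dimension. -/

noncomputable section

namespace CoGor

/-! ### Stable syzygies and the reduction to chains of syzygies -/

section General

variable {C : Type u} [Category.{v} C] [Abelian C]

/-- Maps between syzygies that lift the same map are stably equal. -/
lemma stableRel_of_shortComplex_maps {S T : ShortComplex C} [Projective S.X₂] (hT : T.ShortExact)
    (φ ψ : S ⟶ T) (h : φ.τ₃ = ψ.τ₃) : stableRel C φ.τ₁ ψ.τ₁ := by
  have := hT.mono_f
  refine ⟨S.X₂, inferInstance, S.f, hT.exact.lift (φ.τ₂ - ψ.τ₂) ?_, ?_⟩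
  · rw [Preadditive.sub_comp, φ.comm₂₃, ψ.comm₂₃, h, sub_self]
  · rw [← cancel_mono T.f, Category.assoc, hT.exact.lift_f, Preadditive.comp_sub,
      Preadditive.sub_comp, φ.comm₁₂, ψ.comm₁₂]

/-- Every map lifts along short exact sequences whose source has a projective middle term. -/
lemma exists_shortComplex_map {S T : ShortComplex C} [Projective S.X₂] (hT : T.ShortExact)
    (f : S.X₃ ⟶ T.X₃) : ∃ φ : S ⟶ T, φ.τ₃ = f := by
  have := hT.mono_f
  have := hT.epi_g
  let g : S.X₂ ⟶ T.X₂ := Projective.factorThru (S.g ≫ f) T.g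
  have hg : g ≫ T.g = S.g ≫ f := Projective.factorThru_comp _ _
  exact ⟨{ τ₁ := hT.exact.lift (S.f ≫ g) (by rw [Category.assoc, hg, S.zero_assoc, zero_comp])
           τ₂ := g
           τ₃ := f
           comm₁₂ := hT.exact.lift_f _ _
           comm₂₃ := hg }, rfl⟩

/-- A lift of a map to a map of short complexes. -/
def shortComplexMap {S T : ShortComplex C} [Projective S.X₂] (hT : T.ShortExact)
    (f : S.X₃ ⟶ T.X₃) : S ⟶ T := (exists_shortComplex_map hT f).choose

@[simp] lemma shortComplexMap_τ₃ {S T : ShortComplex C} [Projective S.X₂] (hT : T.ShortExact)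
    (f : S.X₃ ⟶ T.X₃) : (shortComplexMap hT f).τ₃ = f := (exists_shortComplex_map hT f).choose_spec

lemma toStable_map_eq_iff {X Y : C} (f g : X ⟶ Y) :
    (toStable C).map f = (toStable C).map g ↔ stableRel C f g :=
  CategoryTheory.Quotient.functor_map_eq_iff _ _ _

/-- A stably trivial identity factors through a projective and exhibits `X` as a retract of it. -/
lemma isZero_toStable_iff {X : C} : IsZero ((toStable C).obj X) ↔ Projective X := by
  constructor
  · intro h
    obtain ⟨P, hP, a, b, hab⟩ := (toStable_map_eq_iff (𝟙 X) 0).1 (h.eq_of_src _ _)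
    exact Retract.projective (p := hP) ⟨a, b, by simpa using hab⟩
  · intro h
    have key {Y Z : C} (hYZ : Projective Y ∨ Projective Z)
        (f g : (toStable C).obj Y ⟶ (toStable C).obj Z) : f = g := by
      obtain ⟨f, rfl⟩ := (toStable C).map_surjective f
      obtain ⟨g, rfl⟩ := (toStable C).map_surjective g
      rw [toStable_map_eq_iff]
      rcases hYZ with h | h
      · exact ⟨Y, h, 𝟙 _, f - g, by simp⟩
      · exact ⟨Z, h, f - g, 𝟙 _, by simp⟩
    refine ⟨fun Y => ⟨⟨⟨(toStable C).map (0 : X ⟶ Y.as)⟩, fun f => ?_⟩⟩,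
      fun Y => ⟨⟨⟨(toStable C).map (0 : Y.as ⟶ X)⟩, fun f => ?_⟩⟩⟩
    · exact key (Z := Y.as) (Or.inl h) f _
    · exact key (Y := Y.as) (Or.inr h) f _

variable [EnoughProjectives C]

/-- The short complex defining the chosen syzygy. -/
abbrev syzygyShortComplex (A : C) : ShortComplex C :=
  ShortComplex.mk (syzygyι A) (Projective.π A) (syzygyι_π A)

lemma syzygyShortComplex_shortExact (A : C) : (syzygyShortComplex A).ShortExact where
  exact := ShortComplex.exact_of_f_is_kernel _ (kernelIsKernel (Projective.π A))

/-- Any lift computes `Ω`, not only the chosen `overMap`, since two lifts of one map agree stably on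
kernels. -/
lemma Ω_map {A B : C} (f : A ⟶ B) (φ : syzygyShortComplex A ⟶ syzygyShortComplex B)
    (h : φ.τ₃ = f) : (Ω C).map ((toStable C).map f) = (toStable C).map φ.τ₁ := by
  refine (toStable_map_eq_iff (syzygyMap f) φ.τ₁).2 ?_
  exact stableRel_of_shortComplex_maps (syzygyShortComplex_shortExact B)
    (φ := ⟨syzygyMap f, overMap f, f, by simp, by simp⟩) φ h.symm

/-- The kernel of an epimorphism from a projective object is stably the chosen syzygy. -/
def syzygyIso (S : ShortComplex C) (hS : S.ShortExact) [Projective S.X₂] :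
    (toStable C).obj S.X₁ ≅ (Ω C).obj ((toStable C).obj S.X₃) where
  hom := (toStable C).map (shortComplexMap (S := S) (syzygyShortComplex_shortExact S.X₃) (𝟙 S.X₃)).τ₁
  inv := (toStable C).map (shortComplexMap (S := syzygyShortComplex S.X₃) hS (𝟙 S.X₃)).τ₁
  hom_inv_id := by
    refine ((toStable C).map_comp _ _).symm.trans (Eq.trans ?_ ((toStable C).map_id S.X₁))
    rw [← ShortComplex.comp_τ₁, ← ShortComplex.id_τ₁, toStable_map_eq_iff]
    exact stableRel_of_shortComplex_maps hS _ _ (by simp)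
  inv_hom_id := by
    refine ((toStable C).map_comp _ _).symm.trans
      (Eq.trans ?_ ((toStable C).map_id (syzygyShortComplex S.X₃).X₁))
    rw [← ShortComplex.comp_τ₁, ← ShortComplex.id_τ₁, toStable_map_eq_iff]
    exact stableRel_of_shortComplex_maps (syzygyShortComplex_shortExact S.X₃) _ _ (by simp)

/-- Both sides come from maps of short complexes lifting `φ.τ₃`. This allows `Ω` to be computed with
any projective presentation. -/
lemma syzygyIso_naturality {S T : ShortComplex C} (hS : S.ShortExact) (hT : T.ShortExact)
    [Projective S.X₂] [Projective T.X₂] (φ : S ⟶ T) :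
    (toStable C).map φ.τ₁ ≫ (syzygyIso T hT).hom =
      (syzygyIso S hS).hom ≫ (Ω C).map ((toStable C).map φ.τ₃) := by
  rw [Ω_map φ.τ₃ (shortComplexMap (syzygyShortComplex_shortExact T.X₃) φ.τ₃) (by simp)]
  change (toStable C).map _ ≫ (toStable C).map _ = (toStable C).map _ ≫ (toStable C).map _
  rw [← (toStable C).map_comp, ← (toStable C).map_comp, ← ShortComplex.comp_τ₁,
    ← ShortComplex.comp_τ₁, toStable_map_eq_iff]
  exact stableRel_of_shortComplex_maps (syzygyShortComplex_shortExact T.X₃) _ _ (by simp)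

open scoped ZeroObject in
lemma isZero_Ω_of_projective (P : C) [Projective P] : IsZero ((Ω C).obj ((toStable C).obj P)) := by
  let S : ShortComplex C := ShortComplex.mk (0 : (0 : C) ⟶ P) (𝟙 P) (by simp)
  have hS : S.ShortExact :=
    { exact := (S.exact_iff_mono rfl).2 (inferInstanceAs (Mono (𝟙 P)))
      mono_f := ⟨fun _ _ _ => (isZero_zero C).eq_of_tgt _ _⟩
      epi_g := inferInstanceAs (Epi (𝟙 P)) }
  have : Projective S.X₂ := ‹_›
  exact (isZero_toStable_iff.2 (isZero_zero C).projective).of_iso (syzygyIso S hS).symm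

/-- If every infinite chain of stable syzygies is zero, then only projective objects are in the
image of the costabilization, and the category is `𝒫`-Co-Gorenstein. -/
theorem isPCoGorenstein_of_chains
    (h : ∀ A : ℕ → C, (∀ n, Nonempty ((toStable C).obj (A n) ≅
      (Ω C).obj ((toStable C).obj (A (n + 1))))) → Projective (A 0)) : IsPCoGorenstein C := by
  have hz (A : Costabilization (Ω C)) (i : ℤ) : IsZero (A.obj i) := by
    change IsZero ((toStable C).obj (A.obj i).as)
    rw [isZero_toStable_iff]
    -- Every position `i` of the `ℤ`-indexed sequence starts an `ℕ`-indexed chain.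
    have := h (fun n => (A.obj (i + n)).as) (fun n => by
      have e : Nonempty (A.obj (i + n) ≅ (Ω C).obj (A.obj (i + n + 1))) := ⟨A.iso _⟩
      rw [add_assoc] at e
      push_cast
      exact e)
    simpa using this
  have himg (X : C) : (Costabilization.forget (Ω C)).essImage ((toStable C).obj X) ↔
      Projective X := by
    constructor
    · rintro ⟨A, ⟨e⟩⟩
      exact isZero_toStable_iff.1 ((hz A 0).of_iso e.symm)
    · intro hX
      let e : (toStable C).obj X ≅ (Ω C).obj ((toStable C).obj X) :=
        (isZero_toStable_iff.2 hX).iso (isZero_Ω_of_projective X)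
      exact ⟨⟨fun _ => (toStable C).obj X, fun _ => e⟩, ⟨Iso.refl _⟩⟩
  refine ⟨⟨fun {A B} f => ?_⟩, ⟨fun {A B} f g _ => ?_⟩, fun S hS h₁ h₃ => ?_⟩
  · exact ⟨{ app := fun n => (hz A n).to_ _, comm := fun n => (hz A n).eq_of_src _ _ },
      (hz A 0).eq_of_src _ _⟩
  · exact Costabilization.Hom.ext (funext fun n => (hz A n).eq_of_src _ _)
  · rw [himg] at h₁ h₃ ⊢
    have hs := hS.splittingOfProjective
    exact Projective.of_iso hs.isoBinaryBiproduct.symm inferInstance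

/-- If every infinite chain of stable syzygies is zero, then `Ω^∞` consists of the projective
objects. -/
theorem omegaInfty_eq_projective_of_chains
    (h : ∀ A : ℕ → C, (∀ n, Nonempty ((toStable C).obj (A n) ≅
      (Ω C).obj ((toStable C).obj (A (n + 1))))) → Projective (A 0)) :
    OmegaInfty C = fun A => Projective A := by
  funext A
  refine propext ⟨?_, fun hA => ?_⟩
  · rintro ⟨P, i, d, w₀, w, hP, hi, h₀, hd⟩
    have : Mono (ShortComplex.mk i (d 0) w₀).f := hi
    let e : A ≅ kernel (d 0) := IsLimit.conePointUniqueUpToIso h₀.fIsKernel (limit.isLimit (parallelPair (d 0) 0))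
    refine Projective.of_iso e.symm (h (fun n => kernel (d n)) fun n => ?_)
    -- By exactness `d n` maps `P n` onto `kernel (d (n + 1))`, so consecutive kernels are linked by
    -- syzygies.
    let S : ShortComplex C := ShortComplex.mk (kernel.ι (d n)) (kernel.lift _ (d n) (w n))
      (by simp [← cancel_mono (kernel.ι (d (n + 1)))])
    have : Projective S.X₂ := hP n
    refine ⟨syzygyIso S ?_⟩
    refine { exact := ?_, mono_f := inferInstanceAs (Mono (kernel.ι (d n))),
             epi_g := (hd n).epi_kernelLift }
    refine S.exact_of_f_is_kernel (KernelFork.IsLimit.ofι' _ _ fun {Z} k hk => ?_)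
    refine ⟨kernel.lift (d n) k ?_, kernel.lift_ι _ _ _⟩
    have := hk =≫ kernel.ι (d (n + 1))
    simpa [S] using this
  -- The resolution is `A → A → A → A → ⋯` with maps `1, 0, 1, 0, …`, beginning with the inclusion
  -- `𝟙 A`.
  · refine ⟨fun _ => A, 𝟙 A, fun n => if Even n then 0 else 𝟙 A, by simp, fun n => ?_, fun _ => hA,
      inferInstance, ?_, fun n => ?_⟩
    · by_cases hn : Even n <;> simp [hn, Nat.even_add_one]
    · rw [ShortComplex.exact_iff_epi _ (by simp)]
      exact inferInstanceAs (Epi (𝟙 A))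
    · by_cases hn : Even n
      · rw [ShortComplex.exact_iff_mono _ (by simp [hn])]
        simp only [Nat.even_add_one, hn, not_true_eq_false, if_false]
        infer_instance
      · rw [ShortComplex.exact_iff_epi _ (by simp [hn, Nat.even_add_one])]
        simp only [hn, if_false]
        infer_instance

end General

/-! ### Local rings and modules killed by the maximal ideal -/

section LinearAlgebra

open IsLocalRing

lemma isTorsionBySet_finsupp {R ι M : Type*} [CommRing R] [AddCommGroup M] [Module R M] {s : Set R}
    (h : Module.IsTorsionBySet R M s) : Module.IsTorsionBySet R (ι →₀ M) s :=
  fun x r => Finsupp.ext fun i => @h (x i) r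

variable {R : Type u} [CommRing R] [IsLocalRing R]

/-- A map between modules killed by the maximal ideal that factors through a projective module
vanishes, unless the ring is a field. -/
lemma comp_eq_zero_of_projective {M P N : Type*} [AddCommGroup M] [Module R M] [AddCommGroup P]
    [Module R P] [Module.Projective R P] [AddCommGroup N] [Module R N]
    (h0 : maximalIdeal R ≠ ⊥) (hM : Module.IsTorsionBySet R M (maximalIdeal R))
    (hN : Module.IsTorsionBySet R N (maximalIdeal R)) (a : M →ₗ[R] P) (b : P →ₗ[R] N) :
    b ∘ₗ a = 0 := by
  obtain ⟨s, hs⟩ := Module.projective_def'.1 (inferInstance : Module.Projective R P)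
  -- A nonzero `r` in the maximal ideal kills `a x`, so no coordinate of `s (a x)` can be a unit.
  -- Thus `a x` lies in the maximal ideal times `P`, which `b` sends to zero.
  obtain ⟨r, hr, hr0⟩ := Submodule.exists_mem_ne_zero_of_ne_bot h0
  ext x
  have hc (p : P) : s (a x) p ∈ maximalIdeal R := by
    rw [mem_maximalIdeal, mem_nonunits_iff]
    intro hu
    apply hr0
    have h1 : r • s (a x) = 0 := by
      rw [← map_smul, ← map_smul, (@hM x ⟨r, hr⟩ : r • x = 0), map_zero, map_zero]
    have h2 : r * s (a x) p = 0 := by simpa using DFunLike.congr_fun h1 p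
    exact (hu.mul_left_eq_zero).1 h2
  have h3 : a x = Finsupp.linearCombination R id (s (a x)) := (LinearMap.congr_fun hs (a x)).symm
  rw [LinearMap.comp_apply, h3, Finsupp.linearCombination_apply, Finsupp.sum, map_sum]
  exact Finset.sum_eq_zero fun p _ => by rw [map_smul]; exact @hN (b p) ⟨_, hc p⟩

lemma isTorsionBySet_residueField :
    Module.IsTorsionBySet R (ResidueField R) (maximalIdeal R) := fun x r => by
  change (r : R) • x = 0
  rw [Algebra.smul_def, ResidueField.algebraMap_eq, (residue_eq_zero_iff _).2 r.2, zero_mul]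

lemma isTorsionBySet_maximalIdeal (h2 : maximalIdeal R ^ 2 = ⊥) :
    Module.IsTorsionBySet R (maximalIdeal R) (maximalIdeal R) := fun x r => by
  ext
  have := Ideal.mul_mem_mul r.2 x.2
  rw [← pow_two, h2] at this
  exact this

lemma exists_linearEquiv_finsupp_residueField {M : Type*} [AddCommGroup M] [Module R M]
    [Module.Finite R M] (hM : Module.IsTorsionBySet R M (maximalIdeal R)) :
    ∃ n : ℕ, Nonempty (M ≃ₗ[R] (Fin n →₀ ResidueField R)) := by
  let : Module (ResidueField R) M := hM.module
  have : IsScalarTower R (ResidueField R) M := hM.isScalarTower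
  have : Module.Finite (ResidueField R) M := Module.Finite.of_restrictScalars_finite R _ _
  exact ⟨_, ⟨(Module.finBasis (ResidueField R) M).repr.restrictScalars R⟩⟩

/-- Surjectivity of the residue map makes `e` linear over the residue field, where dimensions can be
compared. -/
lemma eq_of_linearEquiv_finsupp_residueField {a b : Type} [Fintype a] [Fintype b]
    (e : (a →₀ ResidueField R) ≃ₗ[R] (b →₀ ResidueField R)) : Fintype.card a = Fintype.card b := by
  have := (e.extendScalarsOfSurjective (S := ResidueField R) residue_surjective).finrank_eq
  simpa using this

/-- Finitely generated modules over a local ring have a cover whose kernel has coordinates in the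
maximal ideal. -/
lemma exists_minimal_cover (M : Type*) [AddCommGroup M] [Module R M] [Module.Finite R M] :
    ∃ (n : ℕ) (g : (Fin n →₀ R) →ₗ[R] M), Function.Surjective g ∧
      ∀ v, g v = 0 → ∀ i, v i ∈ maximalIdeal R := by
  let N : Submodule R M := maximalIdeal R • ⊤
  obtain ⟨n, ⟨e⟩⟩ := exists_linearEquiv_finsupp_residueField (M := M ⧸ N)
    (Module.isTorsionBySet_quotient_ideal_smul M (maximalIdeal R))
  let p : (Fin n →₀ R) →ₗ[R] (Fin n →₀ ResidueField R) :=
    Finsupp.mapRange.linearMap (Algebra.linearMap R (ResidueField R))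
  have hp : Function.Surjective p :=
    Finsupp.mapRange_surjective _ (map_zero _) residue_surjective
  obtain ⟨g, hg⟩ := Module.projective_lifting_property N.mkQ (e.symm.toLinearMap ∘ₗ p)
    N.mkQ_surjective
  refine ⟨n, g, ?_, fun v hv i => ?_⟩
  -- Nakayama: a map onto `M` modulo the maximal ideal is onto `M`.
  · rw [← LinearMap.range_eq_top, ← map_mkQ_eq_top, ← LinearMap.range_comp, hg,
      LinearMap.range_eq_top]
    exact e.symm.surjective.comp hp
  · have h1 := LinearMap.congr_fun hg v
    rw [LinearMap.comp_apply, hv, map_zero, LinearMap.comp_apply] at h1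
    have h2 : p v = 0 := e.symm.injective (h1.symm.trans (map_zero e.symm).symm)
    exact (residue_eq_zero_iff _).1 (DFunLike.congr_fun h2 i)

lemma exists_maximalIdeal_linearEquiv [IsNoetherianRing R] (h2 : maximalIdeal R ^ 2 = ⊥)
    (hp : ¬ (maximalIdeal R).IsPrincipal) :
    ∃ d, 2 ≤ d ∧ Nonempty (maximalIdeal R ≃ₗ[R] (Fin d →₀ ResidueField R)) := by
  obtain ⟨d, ⟨e⟩⟩ := exists_linearEquiv_finsupp_residueField (isTorsionBySet_maximalIdeal h2)
  refine ⟨d, ?_, ⟨e⟩⟩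
  by_contra! hd
  apply hp
  have hs : Subsingleton (Fin d) := Fin.subsingleton_iff_le_one.2 (by lia)
  -- With at most one coordinate, the vector of ones generates; it is zero when `d = 0`.
  let v : maximalIdeal R := e.symm (Finsupp.equivFunOnFinite.symm fun _ => 1)
  refine ⟨(v : R), le_antisymm (fun x hx => ?_) ?_⟩
  · rw [Submodule.mem_span_singleton]
    obtain ⟨r, hr⟩ : ∃ r : R, ∀ i, residue R r = e ⟨x, hx⟩ i := by
      rcases isEmpty_or_nonempty (Fin d) with h | ⟨⟨i⟩⟩
      · exact ⟨0, fun i => isEmptyElim i⟩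
      · obtain ⟨r, hr⟩ := residue_surjective (e ⟨x, hx⟩ i)
        exact ⟨r, fun j => by rw [hr, Subsingleton.elim i j]⟩
    refine ⟨r, ?_⟩
    have : r • v = ⟨x, hx⟩ := by
      apply e.injective
      ext i
      rw [map_smul, LinearEquiv.apply_symm_apply, Finsupp.smul_apply, ← hr i, Algebra.smul_def]
      simp
    exact congrArg Subtype.val this
  · rw [Submodule.span_singleton_le_iff_mem]
    exact v.2

/-- There is an endomorphism of the maximal ideal that is not a multiplication. -/
lemma exists_endomorphism_not_mem_span [IsNoetherianRing R] (h2 : maximalIdeal R ^ 2 = ⊥)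
    (hp : ¬ (maximalIdeal R).IsPrincipal) :
    ∃ (s : maximalIdeal R →ₗ[R] maximalIdeal R) (x : maximalIdeal R), ∀ r : R, r * x ≠ s x := by
  obtain ⟨d, hd, ⟨e⟩⟩ := exists_maximalIdeal_linearEquiv h2 hp
  let i : Fin d := ⟨0, by lia⟩
  let j : Fin d := ⟨1, by lia⟩
  have hij : i ≠ j := by simp [i, j]
  -- The swap takes basis vector `i` to basis vector `j`, whereas a multiple of the former has
  -- `j`-coordinate zero.
  refine ⟨e.symm.toLinearMap ∘ₗ Finsupp.lmapDomain _ R (Equiv.swap i j) ∘ₗ e.toLinearMap,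
    e.symm (Finsupp.single i 1), fun r hr => ?_⟩
  have h1 : r • e.symm (Finsupp.single i 1) = e.symm (Finsupp.single j 1) := by
    ext
    simpa using hr
  rw [← map_smul] at h1
  have h2 := DFunLike.congr_fun (e.symm.injective h1) j
  simp [hij] at h2

end LinearAlgebra

/-! ### Arbitrary modules: failure of fullness and infinite injective dimension -/

section ModuleCategories

open IsLocalRing

variable {R : Type u} [CommRing R] [IsLocalRing R]

variable (R) in
/-- The inclusion of a sum of copies of the maximal ideal into a free module. -/
def finsuppInclusion (ι : Type*) : (ι →₀ maximalIdeal R) →ₗ[R] (ι →₀ R) :=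
  Finsupp.mapRange.linearMap (maximalIdeal R).subtype

variable (R) in
/-- The projection from a free module to a sum of copies of the residue field. -/
def finsuppResidue (ι : Type*) : (ι →₀ R) →ₗ[R] (ι →₀ ResidueField R) :=
  Finsupp.mapRange.linearMap (Algebra.linearMap R (ResidueField R))

lemma finsuppInclusion_injective (ι : Type*) : Function.Injective (finsuppInclusion R ι) :=
  Finsupp.mapRange_injective _ (map_zero _) (maximalIdeal R).injective_subtype

lemma finsuppResidue_surjective (ι : Type*) : Function.Surjective (finsuppResidue R ι) :=
  Finsupp.mapRange_surjective _ (map_zero _) residue_surjective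

lemma exact_finsuppInclusion_finsuppResidue (ι : Type*) :
    Function.Exact (finsuppInclusion R ι) (finsuppResidue R ι) := by
  intro v
  constructor
  · intro hv
    have h (i : ι) : v i ∈ maximalIdeal R :=
      (residue_eq_zero_iff _).1 (DFunLike.congr_fun hv i)
    exact ⟨Finsupp.onFinset v.support (fun i => ⟨v i, h i⟩) (fun i hi => by simpa using hi),
      Finsupp.ext fun i => rfl⟩
  · rintro ⟨w, rfl⟩
    exact Finsupp.ext fun i => (residue_eq_zero_iff _).2 (w i).2

/-- The sum of copies of the maximal ideal as a sum of copies of the residue field. -/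
def finsuppMaximalIdealEquiv (ι : Type*) {d : ℕ}
    (e : maximalIdeal R ≃ₗ[R] (Fin d →₀ ResidueField R)) :
    (ι →₀ maximalIdeal R) ≃ₗ[R] (ι × Fin d →₀ ResidueField R) :=
  Finsupp.mapRange.linearEquiv e ≪≫ₗ (Finsupp.curryLinearEquiv R).symm

/-- A bijection `ℕ ≃ ℕ × Fin d` absorbs the factor `d`; this is what makes `κ^(ℕ)` its own syzygy.
-/
lemma exists_linearEquiv_finsupp_nat [IsNoetherianRing R] (h2 : maximalIdeal R ^ 2 = ⊥)
    (hp : ¬ (maximalIdeal R).IsPrincipal) :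
    Nonempty ((ℕ →₀ ResidueField R) ≃ₗ[R] (ℕ →₀ maximalIdeal R)) := by
  obtain ⟨d, hd, ⟨e⟩⟩ := exists_maximalIdeal_linearEquiv h2 hp
  have : NeZero d := ⟨by lia⟩
  obtain ⟨f⟩ := nonempty_equiv_of_countable (α := ℕ) (β := ℕ × Fin d)
  exact ⟨Finsupp.domLCongr f ≪≫ₗ (finsuppMaximalIdealEquiv ℕ e).symm⟩

lemma maximalIdeal_ne_bot (hp : ¬ (maximalIdeal R).IsPrincipal) : maximalIdeal R ≠ ⊥ :=
  fun h => hp (h ▸ bot_isPrincipal)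

variable (R) in
/-- The short exact sequence of sums of copies of the maximal ideal, the ring, and the residue
field. -/
abbrev residueShortComplex : ShortComplex (ModuleCat.{u} R) :=
  ShortComplex.mk (ModuleCat.ofHom (finsuppInclusion R ℕ)) (ModuleCat.ofHom (finsuppResidue R ℕ))
    (ModuleCat.hom_ext (exact_finsuppInclusion_finsuppResidue ℕ).linearMap_comp_eq_zero)

lemma residueShortComplex_shortExact : (residueShortComplex R).ShortExact :=
  ModuleCat.shortComplex_shortExact _ (exact_finsuppInclusion_finsuppResidue ℕ)
    (finsuppInclusion_injective ℕ) (finsuppResidue_surjective ℕ)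

instance : Projective (residueShortComplex R).X₂ :=
  (inferInstance : Projective (ModuleCat.of R (ℕ →₀ R)))

lemma finsuppInclusion_single_smul (x : maximalIdeal R) :
    finsuppInclusion R ℕ (Finsupp.single 0 x) = (x : R) • Finsupp.single 0 1 := by
  simp [finsuppInclusion]

/-- Fullness is tested on the constant object at `κ^(ℕ)`, with the non-multiplication `s` applied in
each coordinate of `m^(ℕ)`. -/
theorem not_isPCoGorenstein_moduleCat [IsNoetherianRing R] (h2 : maximalIdeal R ^ 2 = ⊥)
    (hp : ¬ (maximalIdeal R).IsPrincipal) : ¬ IsPCoGorenstein (ModuleCat.{u} R) := by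
  intro hC
  have hfull := hC.full
  obtain ⟨e'⟩ := exists_linearEquiv_finsupp_nat h2 hp
  obtain ⟨s, x, hsx⟩ := exists_endomorphism_not_mem_span h2 hp
  let S := residueShortComplex R
  have hS : S.ShortExact := residueShortComplex_shortExact
  let e : S.X₃ ≅ S.X₁ := e'.toModuleIso
  let A : Costabilization (Ω (ModuleCat.{u} R)) :=
    { obj := fun _ => (toStable _).obj S.X₃
      iso := fun _ => (toStable _).mapIso e ≪≫ syzygyIso S hS }
  let g₀ : S.X₁ ⟶ S.X₁ := ModuleCat.ofHom (Finsupp.mapRange.linearMap s)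
  obtain ⟨F, hF⟩ := hfull.map_surjective (X := A) (Y := A)
    ((toStable _).map (e.hom ≫ g₀ ≫ e.inv))
  obtain ⟨f₁, hf₁⟩ := (toStable _).map_surjective (X := S.X₃) (Y := S.X₃) (F.app (0 + 1))
  let φ : S ⟶ S := shortComplexMap hS f₁
  have hφ : φ.τ₃ = f₁ := shortComplexMap_τ₃ hS f₁
  have hnat := syzygyIso_naturality hS hS φ
  have hcomm := F.comm 0
  have hF' : F.app 0 = (toStable _).map (e.hom ≫ g₀ ≫ e.inv) := hF
  rw [hF', ← hf₁] at hcomm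
  rw [hφ] at hnat
  -- Compatibility of `F` between degrees `0` and `1` says that `g₀` is stably the syzygy of `f₁`.
  have key : (toStable _).map (e.hom ≫ g₀) = (toStable _).map (e.hom ≫ φ.τ₁) := by
    rw [← cancel_mono (syzygyIso S hS).hom]
    simp only [A, Iso.trans_hom, Functor.mapIso_hom, ← Category.assoc,
      ← Functor.map_comp] at hcomm
    simp only [Category.assoc, Iso.inv_hom_id, Category.comp_id] at hcomm
    rw [hcomm, Functor.map_comp, Category.assoc, hnat]
  rw [toStable_map_eq_iff] at key
  obtain ⟨P, hP, a, b, hab⟩ := key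
  have : Module.Projective R P := (IsProjective.iff_projective P).2 hP
  -- Source and target are killed by the maximal ideal, so the stable equality is an honest one.
  have h0 : b.hom ∘ₗ a.hom = 0 := comp_eq_zero_of_projective (maximalIdeal_ne_bot hp)
    (isTorsionBySet_finsupp isTorsionBySet_residueField)
    (isTorsionBySet_finsupp (isTorsionBySet_maximalIdeal h2)) a.hom b.hom
  have h1 : g₀ = φ.τ₁ := by
    rw [← cancel_epi e.hom, ← sub_eq_zero, ← hab]
    exact ModuleCat.hom_ext h0
  have h3 := congrArg (fun f => f.hom (Finsupp.single 0 x)) φ.comm₁₂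
  rw [← h1] at h3
  have h4 : finsuppInclusion R ℕ (Finsupp.mapRange.linearMap s (Finsupp.single 0 x)) =
      φ.τ₂.hom (finsuppInclusion R ℕ (Finsupp.single 0 x)) := h3
  rw [Finsupp.mapRange.linearMap_apply, Finsupp.mapRange_single, finsuppInclusion_single_smul,
    finsuppInclusion_single_smul, map_smul] at h4
  -- The `(0, 0)` matrix entry of `φ.τ₂` would be a scalar taking `x` to `s x`.
  have h5 : (x : R) * (φ.τ₂.hom (Finsupp.single 0 1) : ℕ →₀ R) 0 =
      ((s x : R) • Finsupp.single 0 1 : ℕ →₀ R) 0 := (DFunLike.congr_fun h4 0).symm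
  refine hsx ((φ.τ₂.hom (Finsupp.single 0 1) : ℕ →₀ R) 0) ?_
  rw [mul_comm, h5]
  simp

-- In degree one, vanishing would extend `s` on coordinate `0` to a map `R^(ℕ) → R`, making `s x` a
-- multiple of `x`. Higher degrees follow by dimension shifting, the syzygy of `κ^(ℕ)` being `κ^(ℕ)`
-- again.
open Abelian in
lemma not_subsingleton_ext [IsNoetherianRing R] (h2 : maximalIdeal R ^ 2 = ⊥)
    (hp : ¬ (maximalIdeal R).IsPrincipal) (n : ℕ) :
    ¬ Subsingleton (Ext (residueShortComplex R).X₃ (ModuleCat.of R R) (n + 1)) := by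
  have hS := residueShortComplex_shortExact (R := R)
  induction n with
  | zero =>
    intro h
    obtain ⟨s, x, hsx⟩ := exists_endomorphism_not_mem_span h2 hp
    let t : (residueShortComplex R).X₁ ⟶ ModuleCat.of R R :=
      ModuleCat.ofHom ((maximalIdeal R).subtype ∘ₗ s ∘ₗ Finsupp.lapply 0)
    obtain ⟨y, hy⟩ := Ext.contravariant_sequence_exact₁ hS (ModuleCat.of R R) (Ext.mk₀ t)
      (add_zero 1) (Subsingleton.elim _ _)
    obtain ⟨q, rfl⟩ := (Ext.mk₀_bijective _ _).2 y
    rw [Ext.mk₀_comp_mk₀] at hy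
    have h1 := (Ext.mk₀_bijective _ _).1 hy
    have h3 : q.hom (finsuppInclusion R ℕ (Finsupp.single 0 x)) = s (Finsupp.single 0 x 0) :=
      congrArg (fun f => f.hom (Finsupp.single 0 x)) h1
    rw [finsuppInclusion_single_smul, map_smul, Finsupp.single_eq_same] at h3
    exact hsx (q.hom (Finsupp.single 0 1)) ((mul_comm _ _).trans h3)
  | succ n ih =>
    intro h
    apply ih
    obtain ⟨e'⟩ := exists_linearEquiv_finsupp_nat h2 hp
    let e : (residueShortComplex R).X₃ ≅ (residueShortComplex R).X₁ := e'.toModuleIso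
    refine subsingleton_of_forall_eq 0 fun y => ?_
    obtain ⟨z, hz⟩ := Ext.contravariant_sequence_exact₁ hS (ModuleCat.of R R)
      ((Ext.mk₀ e.inv).comp y (zero_add _)) (n₁ := n + 1 + 1) (by lia) (Subsingleton.elim _ _)
    rw [z.eq_zero_of_projective, Ext.comp_zero] at hz
    have := congrArg (fun w => (Ext.mk₀ e.hom).comp w (zero_add _)) hz
    simpa using this.symm

theorem not_hasInjectiveDimensionLE [IsNoetherianRing R] (h2 : maximalIdeal R ^ 2 = ⊥)
    (hp : ¬ (maximalIdeal R).IsPrincipal) (n : ℕ) :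
    ¬ HasInjectiveDimensionLE (ModuleCat.of R R) n := fun _ =>
  not_subsingleton_ext h2 hp n
    (HasInjectiveDimensionLT.subsingleton (ModuleCat.of R R) (n + 1) (n + 1) le_rfl _)

end ModuleCategories

attribute [local instance] Abelian.hasFiniteBiproducts

/-! ### Finitely generated modules: counting copies of the residue field -/

section FGModules

lemma shortExact_of_fgModuleCat {R : Type u} [Ring R] [IsNoetherianRing R]
    (S : ShortComplex (FGModuleCat.{u} R)) (hi : Function.Injective S.f.hom.hom)
    (he : Function.Exact S.f.hom.hom S.g.hom.hom) (hs : Function.Surjective S.g.hom.hom) :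
    S.ShortExact := by
  let F := forget₂ (FGModuleCat.{u} R) (ModuleCat.{u} R)
  have h : (S.map F).ShortExact := ModuleCat.shortComplex_shortExact _ he hi hs
  have := h.mono_f
  have := h.epi_g
  exact { exact := (ShortComplex.exact_map_iff_of_faithful S F).1 h.exact
          mono_f := F.mono_of_mono_map h.mono_f
          epi_g := F.epi_of_epi_map h.epi_g }

lemma projective_fgModuleCat {R : Type u} [Ring R] [IsNoetherianRing R] (X : FGModuleCat.{u} R)
    [Module.Projective R X] : Projective X := by
  apply (forget₂ (FGModuleCat.{u} R) (ModuleCat.{u} R)).projective_of_map_projective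
  exact (inferInstance : Projective (ModuleCat.of R X))

lemma projective_biproduct_fin {C : Type u} [Category.{v} C] [Abelian C] (n : ℕ) (X : C)
    [Projective X] : Projective (⨁ fun _ : Fin n => X) where
  factors f e _ := ⟨biproduct.desc fun i => Projective.factorThru (biproduct.ι (fun _ : Fin n => X) i ≫ f) e,
    biproduct.hom_ext' _ _ fun i => by simp⟩

/-- The finitely generated projective modules are the retracts of finite sums of the ring. -/
lemma projective_eq_addClosure {R : Type u} [Ring R] [IsNoetherianRing R] (X : FGModuleCat.{u} R)
    (e : R ≃ₗ[R] X) :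
    (fun M : FGModuleCat.{u} R => Projective M) = addClosure X := by
  have hX : Projective X :=
    have := Module.Projective.of_equiv e
    projective_fgModuleCat X
  funext M
  refine propext ⟨fun hM => ?_, fun ⟨n, ⟨r⟩⟩ =>
    have := projective_biproduct_fin n X
    r.projective⟩
  obtain ⟨n, m, hm⟩ := Module.Finite.exists_fin (R := R) (M := M)
  let c (i : Fin n) : X ⟶ M :=
    ObjectProperty.homMk (ModuleCat.ofHom (LinearMap.toSpanSingleton R M (m i) ∘ₗ e.symm))
  have hc (i : Fin n) : (c i).hom.hom (e 1) = m i := by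
    change LinearMap.toSpanSingleton R M (m i) (e.symm (e 1)) = m i
    simp
  let p : (⨁ fun _ : Fin n => X) ⟶ M := biproduct.desc c
  have hp : Epi p := by
    refine Preadditive.epi_of_cancel_zero _ fun {Z} g hg => ?_
    have h1 (i : Fin n) : c i ≫ g = 0 := by
      rw [← biproduct.ι_desc c i, Category.assoc, hg, comp_zero]
    refine FGModuleCat.hom_ext (LinearMap.ext_on_range hm fun i => ?_)
    rw [← hc i]
    exact congrArg (fun f => f.hom.hom (e 1)) (h1 i)
  exact ⟨n, ⟨⟨Projective.factorThru (𝟙 M) p, p, Projective.factorThru_comp _ _⟩⟩⟩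

open IsLocalRing

variable {R : Type u} [CommRing R] [IsLocalRing R] [IsNoetherianRing R]

/-- A stable isomorphism between finitely generated modules killed by the maximal ideal is an
isomorphism. -/
lemma nonempty_linearEquiv_of_stable_iso (h0 : maximalIdeal R ≠ ⊥) {M N : FGModuleCat.{u} R}
    (hM : Module.IsTorsionBySet R M (maximalIdeal R))
    (hN : Module.IsTorsionBySet R N (maximalIdeal R))
    (e : (toStable (FGModuleCat.{u} R)).obj M ≅ (toStable _).obj N) :
    Nonempty (M ≃ₗ[R] N) := by
  have key {X : FGModuleCat.{u} R} (hX : Module.IsTorsionBySet R X (maximalIdeal R)) (f : X ⟶ X)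
      (h : (toStable _).map f = (toStable _).map (𝟙 X)) : f = 𝟙 X := by
    obtain ⟨P, hP, a, b, hab⟩ := (toStable_map_eq_iff _ _).1 h
    -- A projective object here is a retract of a finite free module, hence a projective module.
    have : Module.Projective R P := by
      obtain ⟨n, g, hg⟩ := Module.Finite.exists_fin' R P
      let F := FGModuleCat.of R (Fin n → R)
      let q : F ⟶ P := ObjectProperty.homMk (ModuleCat.ofHom g)
      have hq : Epi q := by
        have : Epi ((forget₂ (FGModuleCat.{u} R) (ModuleCat.{u} R)).map q) :=
          (ModuleCat.epi_iff_surjective _).2 hg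
        exact (forget₂ (FGModuleCat.{u} R) (ModuleCat.{u} R)).epi_of_epi_map this
      have h := Projective.factorThru_comp (𝟙 P) q
      exact Module.Projective.of_split (Projective.factorThru (𝟙 P) q).hom.hom g
        (congrArg (fun f => f.hom.hom) h)
    have hz : b.hom.hom ∘ₗ a.hom.hom = 0 := comp_eq_zero_of_projective h0 hX hX _ _
    rw [← sub_eq_zero, ← hab]
    exact FGModuleCat.hom_ext hz
  obtain ⟨f, hf⟩ := (toStable _).map_surjective e.hom
  obtain ⟨g, hg⟩ := (toStable _).map_surjective e.inv
  have h1 : f ≫ g = 𝟙 M := key hM _ (by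
    rw [Functor.map_comp, hf, hg, e.hom_inv_id, (toStable _).map_id])
  have h2 : g ≫ f = 𝟙 N := key hN _ (by
    rw [Functor.map_comp, hf, hg, e.inv_hom_id, (toStable _).map_id])
  exact ⟨FGModuleCat.isoToLinearEquiv ⟨f, g, h1, h2⟩⟩

/-- The stable syzygy of a finitely generated module is a sum of copies of the residue field. -/
lemma exists_stable_iso_syzygy (h2 : maximalIdeal R ^ 2 = ⊥) (M : FGModuleCat.{u} R) :
    ∃ n : ℕ, Nonempty ((Ω (FGModuleCat.{u} R)).obj ((toStable _).obj M) ≅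
      (toStable _).obj (FGModuleCat.of R (Fin n →₀ ResidueField R))) := by
  obtain ⟨a, g, hg, hker⟩ := exists_minimal_cover (R := R) M
  obtain ⟨n, ⟨e⟩⟩ := exists_linearEquiv_finsupp_residueField (R := R) (M := LinearMap.ker g) (by
    intro x r
    ext i
    have := Ideal.mul_mem_mul r.2 (hker x.1 x.2 i)
    rw [← pow_two, h2] at this
    exact this)
  let S : ShortComplex (FGModuleCat.{u} R) :=
    { X₁ := FGModuleCat.of R (LinearMap.ker g)
      X₂ := FGModuleCat.of R (Fin a →₀ R)
      X₃ := M
      f := ObjectProperty.homMk (ModuleCat.ofHom (LinearMap.ker g).subtype)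
      g := ObjectProperty.homMk (ModuleCat.ofHom g)
      zero := FGModuleCat.hom_ext (LinearMap.ext fun x => x.2) }
  have hS : S.ShortExact := shortExact_of_fgModuleCat S (LinearMap.ker g).injective_subtype
    (LinearMap.exact_subtype_ker_map g) hg
  have : Projective S.X₂ := projective_fgModuleCat (FGModuleCat.of R (Fin a →₀ R))
  exact ⟨n, ⟨(syzygyIso S hS).symm ≪≫ (toStable _).mapIso e.toFGModuleCatIso⟩⟩

/-- Covering `κ^n` by `R^n` leaves the kernel `m^n`, so `Ω` multiplies the number of copies by `d`.
-/
lemma nonempty_stable_iso_syzygy_residueField (n : ℕ) {d : ℕ}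
    (e : maximalIdeal R ≃ₗ[R] (Fin d →₀ ResidueField R)) :
    Nonempty ((Ω (FGModuleCat.{u} R)).obj ((toStable _).obj
        (FGModuleCat.of R (Fin n →₀ ResidueField R))) ≅
      (toStable _).obj (FGModuleCat.of R (Fin n × Fin d →₀ ResidueField R))) := by
  let S : ShortComplex (FGModuleCat.{u} R) :=
    { X₁ := FGModuleCat.of R (Fin n →₀ maximalIdeal R)
      X₂ := FGModuleCat.of R (Fin n →₀ R)
      X₃ := FGModuleCat.of R (Fin n →₀ ResidueField R)
      f := ObjectProperty.homMk (ModuleCat.ofHom (finsuppInclusion R (Fin n)))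
      g := ObjectProperty.homMk (ModuleCat.ofHom (finsuppResidue R (Fin n)))
      zero := FGModuleCat.hom_ext
        (exact_finsuppInclusion_finsuppResidue (Fin n)).linearMap_comp_eq_zero }
  have hS : S.ShortExact := shortExact_of_fgModuleCat S (finsuppInclusion_injective (Fin n))
    (exact_finsuppInclusion_finsuppResidue (Fin n)) (finsuppResidue_surjective (Fin n))
  have : Projective S.X₂ := projective_fgModuleCat (FGModuleCat.of R (Fin n →₀ R))
  exact ⟨(syzygyIso S hS).symm ≪≫
    (toStable _).mapIso (finsuppMaximalIdealEquiv (Fin n) e).toFGModuleCatIso⟩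

/-- Over a local ring with radical of square zero that is not principal, every infinite chain of
stable syzygies of finitely generated modules is zero. -/
theorem projective_of_syzygy_chain (h2 : maximalIdeal R ^ 2 = ⊥)
    (hp : ¬ (maximalIdeal R).IsPrincipal) (A : ℕ → FGModuleCat.{u} R)
    (hA : ∀ n, Nonempty ((toStable (FGModuleCat.{u} R)).obj (A n) ≅
      (Ω _).obj ((toStable _).obj (A (n + 1))))) : Projective (A 0) := by
  obtain ⟨d, hd, ⟨e⟩⟩ := exists_maximalIdeal_linearEquiv h2 hp
  have hV (n : ℕ) : ∃ c : ℕ, Nonempty ((toStable (FGModuleCat.{u} R)).obj (A n) ≅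
      (toStable _).obj (FGModuleCat.of R (Fin c →₀ ResidueField R))) := by
    obtain ⟨c, ⟨f⟩⟩ := exists_stable_iso_syzygy h2 (A (n + 1))
    exact ⟨c, ⟨(hA n).some ≪≫ f⟩⟩
  choose c hc using hV
  have hrec (n : ℕ) : c n = c (n + 1) * d := by
    obtain ⟨f⟩ := nonempty_stable_iso_syzygy_residueField (R := R) (c (n + 1)) e
    obtain ⟨g⟩ := nonempty_linearEquiv_of_stable_iso (maximalIdeal_ne_bot hp)
      (isTorsionBySet_finsupp isTorsionBySet_residueField)
      (isTorsionBySet_finsupp isTorsionBySet_residueField)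
      ((hc n).some.symm ≪≫ (hA n).some ≪≫ (Ω _).mapIso (hc (n + 1)).some ≪≫ f)
    simpa using eq_of_linearEquiv_finsupp_residueField g
  have hpow (n : ℕ) : c 0 = c n * d ^ n := by
    induction n with
    | zero => simp
    | succ n ih => rw [ih, hrec n, pow_succ']; ring
  have h0 : c 0 = 0 := by
    by_contra hne
    -- Taking the exponent to be `c 0` itself suffices, because `d ^ c 0 > c 0`.
    have h1 := hpow (c 0)
    have h2 : c (c 0) ≠ 0 := fun h => hne (by rw [h1, h, zero_mul])
    have h3 : c 0 < d ^ c 0 := Nat.lt_pow_self (by lia)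
    have h4 := Nat.le_mul_of_pos_left (d ^ c 0) (Nat.pos_of_ne_zero h2)
    lia
  rw [← isZero_toStable_iff]
  refine IsZero.of_iso ?_ (hc 0).some
  rw [isZero_toStable_iff, h0]
  exact projective_fgModuleCat _

end FGModules

/-! ### Trivial square-zero extensions of a field -/

section TruncatedPolynomials

open IsLocalRing

variable {k : Type*} [Field k] {R : Type*} [CommRing R]

/-- A ring isomorphic to a trivial square-zero extension of a field is local. -/
lemma isLocalRing_of_trivSqZeroExt {n : ℕ} (f : R ≃+* TrivSqZeroExt k (Fin n → k)) :
    IsLocalRing R := by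
  have : IsLocalRing (TrivSqZeroExt k (Fin n → k)) := by
    refine IsLocalRing.of_nonunits_add fun a b ha hb => ?_
    rw [mem_nonunits_iff, TrivSqZeroExt.isUnit_iff_isUnit_fst, isUnit_iff_ne_zero, not_not] at *
    rw [TrivSqZeroExt.fst_add, ha, hb, add_zero]
  exact f.symm.isLocalRing

variable [IsLocalRing R]

lemma mem_maximalIdeal_iff_fst {n : ℕ} (f : R ≃+* TrivSqZeroExt k (Fin n → k)) (r : R) :
    r ∈ maximalIdeal R ↔ (f r).fst = 0 := by
  rw [mem_maximalIdeal, mem_nonunits_iff, ← MulEquiv.isUnit_map f,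
    TrivSqZeroExt.isUnit_iff_isUnit_fst, isUnit_iff_ne_zero, not_not]

lemma maximalIdeal_sq_eq_bot {n : ℕ} (f : R ≃+* TrivSqZeroExt k (Fin n → k)) :
    maximalIdeal R ^ 2 = ⊥ := by
  rw [pow_two, eq_bot_iff, Ideal.mul_le]
  intro a ha b hb
  rw [mem_maximalIdeal_iff_fst f] at ha hb
  rw [Ideal.mem_bot]
  apply f.injective
  rw [map_mul, map_zero]
  ext <;> simp [ha, hb]

/-- The ring acts on its maximal ideal through `k`, so one generator would span the plane `Fin 2 →
k`. -/
lemma maximalIdeal_not_isPrincipal (f : R ≃+* TrivSqZeroExt k (Fin 2 → k)) :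
    ¬ (maximalIdeal R).IsPrincipal := by
  rintro ⟨v, hv⟩
  have hv0 : (f v).fst = 0 := by
    rw [← mem_maximalIdeal_iff_fst f, hv]
    exact Submodule.mem_span_singleton_self v
  have key (i : Fin 2) : ∃ c : k, c • (f v).snd = Pi.single i 1 := by
    have h : f.symm (TrivSqZeroExt.inr (Pi.single i 1)) ∈ maximalIdeal R := by
      rw [mem_maximalIdeal_iff_fst f]
      simp
    rw [hv, Submodule.mem_span_singleton] at h
    obtain ⟨r, hr⟩ := h
    refine ⟨(f r).fst, ?_⟩
    have h1 := congrArg (fun t => (f t).snd) hr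
    simpa [hv0] using h1
  obtain ⟨a, ha⟩ := key 0
  obtain ⟨b, hb⟩ := key 1
  have h0 : a * (f v).snd 0 = 1 := by simpa using congrFun ha 0
  have h1 : a * (f v).snd 1 = 0 := by simpa using congrFun ha 1
  have h2 : b * (f v).snd 1 = 1 := by simpa using congrFun hb 1
  rcases mul_eq_zero.1 h1 with h | h
  · simp [h] at h0
  · simp [h] at h2

end TruncatedPolynomials

/-! ### The algebra `k[x, y] / (x², xy, yx, y²)` as a trivial square-zero extension -/

section Lam

open MvPolynomial

variable (k : Type u) [Field k]

/-- The class of a variable in `k[x, y] / (x², xy, yx, y²)`. -/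
abbrev lamX (i : Fin 2) : Lam k := Ideal.Quotient.mk _ (X i)

lemma lamX_mul_lamX (i j : Fin 2) : lamX k i * lamX k j = 0 := by
  rw [← map_mul, Ideal.Quotient.eq_zero_iff_mem]
  apply Ideal.subset_span
  fin_cases i <;> fin_cases j <;> simp [pow_two]

/-- The map to the trivial square-zero extension sending the variables to the basis vectors. -/
def lamToTrivSqZeroExt : Lam k →ₐ[k] TrivSqZeroExt k (Fin 2 → k) :=
  Ideal.Quotient.liftₐ _ (aeval fun i => TrivSqZeroExt.inr (Pi.single i 1)) (by
    intro a ha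
    rw [← RingHom.mem_ker]
    revert a
    change Ideal.span _ ≤ _
    rw [Ideal.span_le]
    rintro a (rfl | rfl | rfl | rfl) <;> simp [RingHom.mem_ker, pow_two])

lemma lamToTrivSqZeroExt_lamX (i : Fin 2) :
    lamToTrivSqZeroExt k (lamX k i) = TrivSqZeroExt.inr (Pi.single i 1) :=
  aeval_X _ i

/-- The map from the trivial square-zero extension sending the basis vectors to the variables. -/
def trivSqZeroExtToLam : TrivSqZeroExt k (Fin 2 → k) →ₐ[k] Lam k :=
  TrivSqZeroExt.liftEquivOfComm ⟨Fintype.linearCombination k (lamX k), fun a b => by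
    simp [Fintype.linearCombination_apply, Fin.sum_univ_two, add_mul, mul_add, lamX_mul_lamX]⟩

lemma trivSqZeroExtToLam_inr (m : Fin 2 → k) :
    trivSqZeroExtToLam k (TrivSqZeroExt.inr m) = Fintype.linearCombination k (lamX k) m := by
  simp [trivSqZeroExtToLam]

/-- The algebra `k[x, y] / (x², xy, yx, y²)` is a trivial square-zero extension of `k`. -/
def lamEquiv : Lam k ≃ₐ[k] TrivSqZeroExt k (Fin 2 → k) :=
  AlgEquiv.ofAlgHom (lamToTrivSqZeroExt k) (trivSqZeroExtToLam k)
    (by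
      apply TrivSqZeroExt.algHom_ext
      intro m
      rw [AlgHom.comp_apply, trivSqZeroExtToLam_inr, Fintype.linearCombination_apply,
        Fin.sum_univ_two, map_add, map_smul, map_smul, lamToTrivSqZeroExt_lamX,
        lamToTrivSqZeroExt_lamX]
      ext i
      · simp
      · fin_cases i <;> simp)
    (by
      apply Ideal.Quotient.algHom_ext
      apply MvPolynomial.algHom_ext
      intro i
      change trivSqZeroExtToLam k (lamToTrivSqZeroExt k (lamX k i)) = lamX k i
      rw [lamToTrivSqZeroExt_lamX, trivSqZeroExtToLam_inr,
        Fintype.linearCombination_apply_single, one_smul])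

lemma finrank_lam : Module.finrank k (Lam k) = 3 := by
  rw [(lamEquiv k).toLinearEquiv.finrank_eq]
  change Module.finrank k (k × (Fin 2 → k)) = 3
  simp

instance isLocalRing_lam : IsLocalRing (Lam k) :=
  isLocalRing_of_trivSqZeroExt (lamEquiv k).toRingEquiv

instance isLocalRing_lam_mop : IsLocalRing (Lam k)ᵐᵒᵖ :=
  isLocalRing_of_trivSqZeroExt ((RingEquiv.toOpposite (Lam k)).symm.trans (lamEquiv k).toRingEquiv)

lemma jacobson_lam_sq : Ring.jacobson (Lam k) ^ 2 = ⊥ := by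
  rw [← Ideal.jacobson_bot, IsLocalRing.jacobson_eq_maximalIdeal _ bot_ne_top]
  exact maximalIdeal_sq_eq_bot (lamEquiv k).toRingEquiv

end Lam

end CoGor

end

theorem mainTheorem6 (k : Type u) [Field k] :
    (Module.finrank k (CoGor.Lam k) = 3 ∧ IsLocalRing (CoGor.Lam k) ∧
      Ring.jacobson (CoGor.Lam k) ^ 2 = ⊥) ∧
    CoGor.IsRightCoGorenstein (CoGor.Lam k) ∧
    ¬ CoGor.IsIwanagaGorenstein (CoGor.Lam k) ∧
    CoGor.OmegaInfty (CoGor.FGRightMod (CoGor.Lam k)) =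
      CoGor.addClosure (FGModuleCat.of (CoGor.Lam k)ᵐᵒᵖ (CoGor.Lam k)) ∧
    ¬ CoGor.IsPCoGorenstein (CoGor.RightMod (CoGor.Lam k)) := by
  let f := (CoGor.lamEquiv k).toRingEquiv
  -- Right modules are modules over the opposite ring, so the two properties of the maximal ideal
  -- are needed there too.
  let g := (RingEquiv.toOpposite (CoGor.Lam k)).symm.trans f
  have h2 := CoGor.maximalIdeal_sq_eq_bot g
  have hp := CoGor.maximalIdeal_not_isPrincipal g
  have hchain := CoGor.projective_of_syzygy_chain h2 hp
  refine ⟨⟨CoGor.finrank_lam k, inferInstance, CoGor.jacobson_lam_sq k⟩,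
    CoGor.isPCoGorenstein_of_chains hchain, fun ⟨⟨n, hn⟩, _⟩ => ?_, ?_,
    CoGor.not_isPCoGorenstein_moduleCat h2 hp⟩
  -- The injective dimension as a left module is already infinite.
  · exact CoGor.not_hasInjectiveDimensionLE (CoGor.maximalIdeal_sq_eq_bot f)
      (CoGor.maximalIdeal_not_isPrincipal f) n hn
  · exact (CoGor.omegaInfty_eq_projective_of_chains hchain).trans
      (CoGor.projective_eq_addClosure _ (MulOpposite.opLinearEquiv (CoGor.Lam k)ᵐᵒᵖ).symm)
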